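/- All graphs are finite, simple, undirected and have at least one vertex. For a graph $G$ and $X\subseteq V(G)$, a connected component $C$ of $G-X$ is a \emph{full component} of $X$ if $N_G(C)=X$, where $N_G(C)$ is the set of vertices outside $C$ with a neighbor in $C$; the set $X$ is a \emph{minimal separator} of $G$ if it has at least two full components. A graph is \emph{chordal} if it has no induced cycle on four or more vertices. A \emph{minimal triangulation} of $G$ is a chordal graph $H$ with $V(H)=V(G)$ and $E(G)\subseteq E(H)$ such that no chordal graph $H'$ with $V(H')=V(G)$ satisfies $E(G)\subseteq E(H')\subsetneq E(H)$. A set $\Omega\subseteq V(G)$ is a \emph{potential maximal clique} of $G$ if it is an inclusion-wise maximal clique of some minimal triangulation of $G$. **Theorem.** Let $G$ be an $n$-vertex graph that contains no induced path on $6$ vertices, and let $k$ be the clique number of $G$, that is, the maximum number of pairwise adjacent vertices. Then $G$ has at most $(2n)^{k+1}$ minimal separators and at most $2^{2k+2}n^{2k+3}$ potential maximal cliques. -/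

import Mathlib

namespace SimpleGraph

variable {V : Type*}

/-- The open neighbourhood `N_G(S)` of a vertex set: the vertices outside `S` with a neighbour
in `S`. -/
def openNbhd (G : SimpleGraph V) (S : Set V) : Set V :=
  {v | v ∉ S ∧ ∃ u ∈ S, G.Adj u v}

/-- A connected component `C` of `G - X` is a full component of `X` if `N_G(C) = X`. -/
def IsFullComponent (G : SimpleGraph V) (X : Set V)
    (C : (G.induce Xᶜ).ConnectedComponent) : Prop :=
  G.openNbhd (Subtype.val '' C.supp) = X

/-- A minimal separator is a vertex set with at least two full components. -/
def IsMinimalSeparator (G : SimpleGraph V) (X : Set V) : Prop :=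
  ∃ A B : (G.induce Xᶜ).ConnectedComponent,
    A ≠ B ∧ G.IsFullComponent X A ∧ G.IsFullComponent X B

/-- A graph is chordal if it has no induced cycle on four or more vertices. -/
def IsChordal (G : SimpleGraph V) : Prop :=
  ∀ m : ℕ, 4 ≤ m → ¬ (cycleGraph m).IsIndContained G

/-- `H` is a triangulation of `G` if it is a chordal graph on the same vertex set that contains
all edges of `G`. -/
def IsTriangulation (G H : SimpleGraph V) : Prop :=
  G ≤ H ∧ H.IsChordal

/-- A minimal triangulation of `G` is a triangulation whose edge set is inclusion-wise minimal. -/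
def IsMinimalTriangulation (G H : SimpleGraph V) : Prop :=
  Minimal G.IsTriangulation H

/-- A potential maximal clique of `G` is a vertex set that is an inclusion-wise maximal clique of
some minimal triangulation of `G`. -/
def IsPotentialMaximalClique (G : SimpleGraph V) (Ω : Set V) : Prop :=
  ∃ H : SimpleGraph V, G.IsMinimalTriangulation H ∧ Maximal H.IsClique Ω

end SimpleGraph

/-!
Let `X` be a minimal separator of a `P₆`-free graph, with full components `A` and `B`. If the
complement of `G[A]` is connected, let `P` be an edge of `G[A]` that lies in no proper module, and
otherwise a transversal of the co-components of `G[A]`. This clique `P` has a neighbour of every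
`x ∈ X` that is not complete to `B`: otherwise an induced `P₄` from `x` into `A` and an induced `P₃`
from `x` into `B` form a `P₆`. So `X` is the neighbourhood of the component of some `b` in what is
left after deleting `P`, its neighbours, and the set `T` of the remaining vertices of `X`. As `T` is
a union of co-components of the undominated neighbourhood of `b`, and one vertex from each
co-component gives a clique, there are at most `2 ^ k` choices for `T`, and hence at most
`2 ^ k * n ^ (k + 1)` minimal separators. The same holds for all induced subgraphs.

Potential maximal cliques are counted as by Bouchitté and Todinca. When a vertex `a` is deleted,
either `Ω \ {a}` stays a potential maximal clique, or `Ω` has the form `S ∪ {a}` or `S ∪ T \ {a}`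
for minimal separators `S` and `T`. So each vertex contributes at most quadratically many in the
number of minimal separators.
-/

namespace SeparatorBounds

open SimpleGraph

section Components

variable {V : Type*} {G H K : SimpleGraph V} {C D S U U' W X : Set V} {a b s w x y z : V}

theorem exists_adj_of_reachable (h : K.Reachable x y) (hx : x ∈ S) (hy : y ∉ S) :
    ∃ a b, K.Reachable x a ∧ K.Adj a b ∧ a ∈ S ∧ b ∉ S := by
  classical
  obtain ⟨p⟩ := h
  obtain ⟨d, hd, ha, hb⟩ := p.exists_boundary_dart S hx hy
  exact ⟨d.fst, d.snd, ⟨p.takeUntil _ (p.dart_fst_mem_support_of_mem_darts hd)⟩, d.adj, ha, hb⟩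

theorem openNbhd_mono (hCD : C ⊆ D) (hs : s ∈ G.openNbhd C) (hsD : s ∉ D) : s ∈ G.openNbhd D :=
  ⟨hsD, hs.2.imp fun _ => And.imp_left (@hCD _)⟩

/-- The vertex set of the connected component of `x` in `G[U]`. For `x ∉ U` this is `{x}`, as the
vertices outside `U` are kept as isolated ones. -/
def compIn (G : SimpleGraph V) (U : Set V) (x : V) : Set V :=
  {y | (G.induce U).spanningCoe.Reachable x y}

theorem spanningCoe_induce_adj :
    (G.induce U).spanningCoe.Adj a b ↔ G.Adj a b ∧ a ∈ U ∧ b ∈ U := by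
  simp

theorem self_mem_compIn : x ∈ compIn G U x := Reachable.refl x

theorem mem_compIn_symm (hy : y ∈ compIn G U x) : x ∈ compIn G U y := Reachable.symm hy

theorem mem_compIn_trans (hy : y ∈ compIn G U x) (hz : z ∈ compIn G U y) : z ∈ compIn G U x :=
  Reachable.trans hy hz

theorem compIn_eq (hy : y ∈ compIn G U x) : compIn G U y = compIn G U x :=
  Set.ext fun _ => ⟨mem_compIn_trans hy, mem_compIn_trans (mem_compIn_symm hy)⟩

theorem mem_compIn_of_adj (hy : y ∈ compIn G U x) (hyU : y ∈ U) (hz : z ∈ U) (h : G.Adj y z) :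
    z ∈ compIn G U x :=
  Reachable.trans hy (spanningCoe_induce_adj.2 ⟨h, hyU, hz⟩).reachable

theorem exists_adj_of_mem_compIn (hy : y ∈ compIn G U x) (hx : x ∈ S) (hyS : y ∉ S) :
    ∃ a b, a ∈ compIn G U x ∧ G.Adj a b ∧ a ∈ U ∧ b ∈ U ∧ a ∈ S ∧ b ∉ S := by
  obtain ⟨a, b, ha, hab, haS, hbS⟩ := exists_adj_of_reachable hy hx hyS
  obtain ⟨hab, haU, hbU⟩ := spanningCoe_induce_adj.1 hab
  exact ⟨a, b, ha, hab, haU, hbU, haS, hbS⟩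

theorem compIn_subset_of_closed (hx : x ∈ S)
    (hS : ∀ a ∈ compIn G U x, ∀ b, G.Adj a b → a ∈ U → b ∈ U → a ∈ S → b ∈ S) :
    compIn G U x ⊆ S := by
  intro y hy
  by_contra hyS
  obtain ⟨a, b, ha, hab, haU, hbU, haS, hbS⟩ := exists_adj_of_mem_compIn hy hx hyS
  exact hbS (hS a ha b hab haU hbU haS)

theorem compIn_subset (hx : x ∈ U) : compIn G U x ⊆ U :=
  compIn_subset_of_closed hx fun _ _ _ _ _ hb _ => hb

theorem compIn_mono (hU : U ⊆ U') : compIn G U x ⊆ compIn G U' x :=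
  compIn_subset_of_closed self_mem_compIn fun _ _ _ hab ha hb ha' =>
    mem_compIn_of_adj ha' (hU ha) (hU hb) hab

theorem compIn_mono_graph (hGH : G ≤ H) : compIn G U x ⊆ compIn H U x :=
  compIn_subset_of_closed self_mem_compIn fun _ _ _ hab ha hb ha' =>
    mem_compIn_of_adj ha' ha hb (hGH hab)

theorem compIn_subset_compIn (hU : compIn G U x ⊆ U') : compIn G U x ⊆ compIn G U' x :=
  compIn_subset_of_closed self_mem_compIn fun _ ha _ hab haU hb ha' =>
    mem_compIn_of_adj ha' (hU ha) (hU (mem_compIn_of_adj ha haU hb hab)) hab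

theorem compIn_subset_compIn_of_mem_openNbhd (hU : compIn G U x ⊆ U') (hw : w ∈ U')
    (hwC : w ∈ G.openNbhd (compIn G U x)) : compIn G U x ⊆ compIn G U' w := by
  obtain ⟨-, y, hy, hyw⟩ := hwC
  have hwy : y ∈ compIn G U' w := mem_compIn_of_adj self_mem_compIn hw (hU hy) hyw.symm
  have hyx : x ∈ compIn G U' y := mem_compIn_symm (compIn_subset_compIn hU hy)
  exact fun z hz => mem_compIn_trans hwy (mem_compIn_trans hyx (compIn_subset_compIn hU hz))

theorem notMem_openNbhd_compIn (hx : x ∈ U) (hy : y ∈ U) : y ∉ G.openNbhd (compIn G U x) :=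
  fun ⟨hyC, _, hz, hzy⟩ => hyC (mem_compIn_of_adj hz (compIn_subset hx hz) hy hzy)

theorem inter_openNbhd_compIn_subset (hx : x ∈ W \ X) :
    W ∩ G.openNbhd (compIn G (W \ X) x) ⊆ X :=
  fun _ hy => by_contra fun hyX => notMem_openNbhd_compIn hx ⟨hy.1, hyX⟩ hy.2

theorem compIn_sdiff_openNbhd_subset (hx : x ∈ C) : compIn G (W \ G.openNbhd C) x ⊆ C :=
  compIn_subset_of_closed hx fun a _ _ hab _ hb ha => by_contra fun hbC => hb.2 ⟨hbC, a, ha, hab⟩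

theorem compIn_sdiff_openNbhd (hUW : U ⊆ W) (hx : x ∈ U) :
    compIn G (W \ G.openNbhd (compIn G U x)) x = compIn G U x :=
  (compIn_sdiff_openNbhd_subset self_mem_compIn).antisymm <|
    compIn_subset_compIn fun _ hy => ⟨hUW (compIn_subset hx hy), fun h => h.1 hy⟩

theorem image_supp_connectedComponentMk (x : U) :
    Subtype.val '' ((G.induce U).connectedComponentMk x).supp = compIn G U x := by
  ext y
  constructor
  · rintro ⟨z, hz, rfl⟩
    exact (ConnectedComponent.exact hz.symm).map (Embedding.spanningCoe _).toHom
  · refine fun hy => compIn_subset_of_closed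
      (S := Subtype.val '' ((G.induce U).connectedComponentMk x).supp) ⟨x, rfl, rfl⟩ ?_ hy
    rintro _ - b hab - hb ⟨a, ha, rfl⟩
    exact ⟨⟨b, hb⟩, ConnectedComponent.mem_supp_of_adj_mem_supp _ ha hab, rfl⟩

theorem connected_induce_compIn : (G.induce (compIn G U x)).Connected := by
  refine (connected_iff_exists_forall_reachable _).2 ⟨⟨x, self_mem_compIn⟩, fun ⟨y, hy⟩ => ?_⟩
  suffices h : compIn G U x ⊆ {y | ∃ hy, (G.induce (compIn G U x)).Reachable
      ⟨x, self_mem_compIn⟩ ⟨y, hy⟩} from (h hy).2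
  refine compIn_subset_of_closed ⟨self_mem_compIn, Reachable.refl _⟩ ?_
  rintro a ha b hab haU hb ⟨_, hxa⟩
  exact ⟨mem_compIn_of_adj ha haU hb hab, hxa.trans (Adj.reachable hab)⟩

end Components

section Domination

variable {V : Type*} {Γ : SimpleGraph V} {M N R S : Set V} {p q : V}

/-- A module of a graph: every vertex outside `M` is adjacent to all of `M` or to none of it. -/
def IsModule (Γ : SimpleGraph V) (M : Set V) : Prop :=
  ∀ z ∉ M, ∀ x ∈ M, ∀ y ∈ M, Γ.Adj z x → Γ.Adj z y

theorem IsModule.union (hM : IsModule Γ M) (hN : IsModule Γ N) (hpM : p ∈ M) (hpN : p ∈ N) :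
    IsModule Γ (M ∪ N) := by
  intro z hz x hx y hy hzx
  have hzM : z ∉ M := fun h => hz (.inl h)
  have hzN : z ∉ N := fun h => hz (.inr h)
  have hzp : Γ.Adj z p := hx.elim (hM z hzM x · p hpM hzx) (hN z hzN x · p hpN hzx)
  exact hy.elim (hM z hzM p hpM y · hzp) (hN z hzN p hpN y · hzp)

theorem IsModule.union_ne_univ (hM : IsModule Γ M) (hN : IsModule Γ N) (hpN : p ∈ N)
    (hM' : M ≠ Set.univ) (hN' : N ≠ Set.univ) (hΓ : Γ.Preconnected) (hΓ' : Γᶜ.Preconnected) :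
    M ∪ N ≠ Set.univ := by
  intro hMN
  obtain ⟨x, hxN⟩ := (Set.ne_univ_iff_exists_notMem N).1 hN'
  obtain ⟨y, hyM⟩ := (Set.ne_univ_iff_exists_notMem M).1 hM'
  have mem_left : ∀ z ∉ N, z ∈ M := fun z => ((Set.eq_univ_iff_forall.1 hMN) z).resolve_right
  have hyN : y ∈ N := ((Set.eq_univ_iff_forall.1 hMN) y).resolve_left hyM
  obtain ⟨a, b, -, hab, haN, hbN⟩ := exists_adj_of_reachable (hΓ p x) hpN hxN
  obtain ⟨c, d, -, hcd, hcN, hdN⟩ := exists_adj_of_reachable (hΓ' p x) hpN hxN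
  have hyb : Γ.Adj y b := (hN b hbN a haN y hyN hab.symm).symm
  have hyd : Γ.Adj y d := hM y hyM b (mem_left b hbN) d (mem_left d hdN) hyb
  exact ((compl_adj _ _ _).1 hcd).2 (hN d hdN y hyN c hcN hyd.symm).symm

theorem exists_adj_forall_isModule_eq_univ [Finite V] [Nontrivial V] (hΓ : Γ.Preconnected)
    (hΓ' : Γᶜ.Preconnected) :
    ∃ p q, Γ.Adj p q ∧ ∀ D, IsModule Γ D → p ∈ D → q ∈ D → D = Set.univ := by
  obtain ⟨a⟩ : Nonempty V := inferInstance
  have ha : IsModule Γ {a} ∧ ({a} : Set V) ≠ Set.univ := by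
    refine ⟨?_, Set.singleton_ne_univ a⟩
    rintro z - x rfl y rfl h
    exact h
  obtain ⟨M, haM, hM⟩ := (Set.toFinite {M | IsModule Γ M ∧ M ≠ Set.univ}).exists_le_maximal ha
  obtain ⟨c, hcM⟩ := (Set.ne_univ_iff_exists_notMem M).1 hM.prop.2
  obtain ⟨p, q, -, hpq, hpM, hqM⟩ := exists_adj_of_reachable (hΓ a c) (haM rfl) hcM
  refine ⟨p, q, hpq, fun D hD hpD hqD => by_contra fun hD' => ?_⟩
  have hMD : M ∪ D ≠ Set.univ := hM.prop.1.union_ne_univ hD hpD hM.prop.2 hD' hΓ hΓ'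
  exact hqM (hM.le_of_ge ⟨hM.prop.1.union hD hpM hpD, hMD⟩ Set.subset_union_left (.inr hqD))

/-- No induced path on three vertices has exactly its first vertex in `S`. For the neighbourhood
`S` of a vertex `v` outside `Γ` this says that no induced path on four vertices leads from `v`
into `Γ`. -/
def NoInducedExit (Γ : SimpleGraph V) (S : Set V) : Prop :=
  ∀ x ∈ S, ∀ y ∉ S, ∀ z ∉ S, Γ.Adj x y → Γ.Adj y z → Γ.Adj x z

theorem NoInducedExit.isModule_compIn_compl (hS : NoInducedExit Γ S) (hp : p ∉ S) :
    IsModule Γ (compIn Γ Sᶜ p) := by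
  intro z hz a ha b hb hza
  have hzS : z ∈ S :=
    by_contra fun hzS => hz (mem_compIn_of_adj ha (compIn_subset hp ha) hzS hza.symm)
  by_contra hzb
  have hab : b ∈ compIn Γ Sᶜ a := mem_compIn_trans (mem_compIn_symm ha) hb
  obtain ⟨c, d, -, hcd, hc, hd, hzc, hzd⟩ :=
    exists_adj_of_mem_compIn (S := {t | Γ.Adj z t}) hab hza hzb
  exact hzd (hS z hzS c hc d hd hzc hcd)

theorem exists_isClique_forall_compl_reachable (Γ : SimpleGraph V) :
    ∃ R, Γ.IsClique R ∧ ∀ v, ∃ r ∈ R, Γᶜ.Reachable v r := by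
  -- The transversals of the components of the complement are cliques.
  refine ⟨Set.range (fun c : Γᶜ.ConnectedComponent => c.out), ?_, fun v =>
    ⟨_, ⟨Γᶜ.connectedComponentMk v, rfl⟩, ConnectedComponent.exact (Quot.out_eq _).symm⟩⟩
  rintro _ ⟨c, rfl⟩ _ ⟨d, rfl⟩ hne
  by_contra hcd
  have h : Γᶜ.Adj c.out d.out := (compl_adj _ _ _).2 ⟨hne, hcd⟩
  refine hne (congrArg Quot.out ?_)
  rw [← Quot.out_eq c, ← Quot.out_eq d]
  exact ConnectedComponent.connectedComponentMk_eq_of_adj h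

theorem NoInducedExit.inter_nonempty (hS : NoInducedExit Γ S) (hne : S.Nonempty)
    (hΓ : ¬ Γᶜ.Preconnected) (hR : ∀ v, ∃ r ∈ R, Γᶜ.Reachable v r) : (S ∩ R).Nonempty := by
  by_contra hSR
  have hRS : ∀ r ∈ R, r ∉ S := fun r hr hrS => hSR ⟨r, hrS, hr⟩
  obtain ⟨y, hy⟩ := hne
  obtain ⟨r, hr, hyr⟩ := hR y
  obtain ⟨c, d, hyc, hcd, hc, hd⟩ := exists_adj_of_reachable hyr hy (hRS r hr)
  obtain ⟨r', hr', hyr'⟩ : ∃ r' ∈ R, ¬ Γᶜ.Reachable y r' := by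
    by_contra! h
    have hy' (z : V) : Γᶜ.Reachable y z :=
      have ⟨s, hs, hzs⟩ := hR z
      (h s hs).trans hzs.symm
    exact hΓ fun u v => (hy' u).symm.trans (hy' v)
  have adj_r' {z : V} (hz : Γᶜ.Reachable y z) : Γ.Adj z r' := by
    by_contra hzr'
    refine hyr' (hz.trans (Adj.reachable ((compl_adj _ _ _).2 ⟨?_, hzr'⟩)))
    rintro rfl
    exact hyr' hz
  exact ((compl_adj _ _ _).1 hcd).2
    (hS c hc r' (hRS r' hr') d hd (adj_r' hyc) (adj_r' (hyc.trans hcd.reachable)).symm)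

theorem exists_isClique_forall_inter_nonempty [Finite V] (hΓ : Γ.Connected) :
    ∃ R, Γ.IsClique R ∧ ∀ S, S.Nonempty → NoInducedExit Γ S → (S ∩ R).Nonempty := by
  have := hΓ.nonempty
  by_cases hΓ' : Γᶜ.Preconnected
  · cases subsingleton_or_nontrivial V
    · refine ⟨Set.univ, fun x _ y _ hne => (hne (Subsingleton.elim x y)).elim, fun S hS _ => ?_⟩
      rwa [Set.inter_univ]
    · obtain ⟨p, q, hpq, hD⟩ := exists_adj_forall_isModule_eq_univ hΓ.preconnected hΓ'
      refine ⟨{p, q}, by simp [hpq], fun S ⟨y, hy⟩ hS => ?_⟩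
      by_contra hpqS
      have hp : p ∉ S := fun h => hpqS ⟨p, h, by simp⟩
      have hq : q ∉ S := fun h => hpqS ⟨q, h, by simp⟩
      have huniv := hD _ (hS.isModule_compIn_compl hp) self_mem_compIn
        (mem_compIn_of_adj self_mem_compIn hp hq hpq)
      exact compIn_subset (U := Sᶜ) hp (huniv ▸ Set.mem_univ y) hy
  · obtain ⟨R, hR, hR'⟩ := exists_isClique_forall_compl_reachable Γ
    exact ⟨R, hR, fun S hne hS => hS.inter_nonempty hne hΓ' hR'⟩

end Domination

section PathFree

variable {V : Type*} {G : SimpleGraph V} {A B : Set V}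

theorem isIndContained_of_forall_adj_iff {W : Type*} {K : SimpleGraph W}
    (hK : Function.Injective K.neighborSet) (f : W → V)
    (hf : ∀ i j, G.Adj (f i) (f j) ↔ K.Adj i j) : K.IsIndContained G := by
  refine ⟨⟨⟨f, fun i j hij => hK (Set.ext fun l => ?_)⟩, hf _ _⟩⟩
  rw [mem_neighborSet, mem_neighborSet, ← hf, ← hf, hij]

theorem injective_neighborSet_pathGraph_six : Function.Injective (pathGraph 6).neighborSet := by
  intro i j h
  have h' : ∀ l, (pathGraph 6).Adj i l ↔ (pathGraph 6).Adj j l := Set.ext_iff.1 h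
  simp only [pathGraph_adj] at h'
  clear h
  revert i j
  decide

theorem exists_isClique_dominating [Finite V] (hP6 : ¬ (pathGraph 6).IsIndContained G)
    (hA : (G.induce A).Connected) (hB : (G.induce B).Preconnected)
    (hAB : ∀ a ∈ A, ∀ b ∈ B, ¬ G.Adj a b) :
    ∃ P ⊆ A, P.Nonempty ∧ G.IsClique P ∧ ∀ v, (∃ a ∈ A, G.Adj v a) → (∃ b ∈ B, G.Adj v b) →
      (∃ p ∈ P, G.Adj v p) ∨ ∀ b ∈ B, G.Adj v b := by
  obtain ⟨R, hR, hRS⟩ := exists_isClique_forall_inter_nonempty hA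
  have := hA.nonempty
  obtain ⟨r, -, hr⟩ := hRS Set.univ Set.univ_nonempty fun _ _ y hy => (hy trivial).elim
  refine ⟨Subtype.val '' R, Subtype.coe_image_subset A R, ⟨r, r, hr, rfl⟩, ?_, ?_⟩
  · rintro _ ⟨x, hx, rfl⟩ _ ⟨y, hy, rfl⟩ hne
    exact hR hx hy (mt (congrArg _) hne)
  rintro v ⟨a, ha, hva⟩ ⟨b, hb, hvb⟩
  by_contra! h
  obtain ⟨hvP, b', hb', hvb'⟩ := h
  obtain ⟨e, f, -, hef, he, hf⟩ :=
    exists_adj_of_reachable (S := {b : B | G.Adj v b}) (hB ⟨b, hb⟩ ⟨b', hb'⟩) hvb hvb'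
  suffices hS : NoInducedExit (G.induce A) {a : A | G.Adj v a} by
    obtain ⟨p, hvp, hp⟩ := hRS _ ⟨⟨a, ha⟩, hva⟩ hS
    exact hvP p ⟨p, hp, rfl⟩ hvp
  intro x hx y hy z hz hxy hyz
  by_contra hxz
  refine hP6 (isIndContained_of_forall_adj_iff injective_neighborSet_pathGraph_six
    ![(z : V), y, x, v, e, f] ?_)
  have hAB' (a : A) (b : B) : ¬ G.Adj a b := hAB a a.2 b b.2
  have hBA (a : A) (b : B) : ¬ G.Adj b a := fun h => hAB' a b h.symm
  simp only [Set.mem_ofPred_eq, comap_adj, Function.Embedding.subtype_apply] at *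
  simp [Fin.forall_fin_succ, pathGraph_adj, *, G.adj_comm _ v, hyz.symm, hxy.symm, hef.symm,
    mt Adj.symm hxz]

end PathFree

section CliqueNumber

variable {V : Type*} {G : SimpleGraph V} {R T Z : Set V} {k : ℕ}

theorem ncard_le_cliqueNum [Finite V] (hR : G.IsClique R) : R.ncard ≤ G.cliqueNum := by
  have := Fintype.ofFinite V
  rw [Set.ncard_eq_toFinset_card R]
  exact IsClique.card_le_cliqueNum (tc := by simpa using hR)

/-- The sets obtained from `Z` by collecting some of the components of the complement of `G[Z]`. -/
def completeSplits (G : SimpleGraph V) (Z : Set V) : Set (Set V) :=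
  {T | T ⊆ Z ∧ ∀ t ∈ T, ∀ z ∈ Z \ T, G.Adj t z}

theorem mem_of_compl_reachable {v w : Z} (hT : T ∈ completeSplits G Z) (hv : (v : V) ∈ T)
    (h : (G.induce Z)ᶜ.Reachable v w) : (w : V) ∈ T := by
  by_contra hw
  obtain ⟨c, d, -, hcd, hc, hd⟩ := exists_adj_of_reachable (S := {z : Z | (z : V) ∈ T}) h hv hw
  exact ((compl_adj _ _ _).1 hcd).2 (hT.2 c hc d ⟨d.2, hd⟩)

theorem ncard_completeSplits_le [Finite V] : (completeSplits G Z).ncard ≤ 2 ^ G.cliqueNum := by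
  obtain ⟨R, hR, hZR⟩ := exists_isClique_forall_compl_reachable (G.induce Z)
  have hle : (Subtype.val '' R).ncard ≤ G.cliqueNum := by
    refine ncard_le_cliqueNum ?_
    rintro _ ⟨x, hx, rfl⟩ _ ⟨y, hy, rfl⟩ hne
    exact hR hx hy (mt (congrArg _) hne)
  have subset_of_inter_eq {S T} (hS : S ∈ completeSplits G Z) (hT : T ∈ completeSplits G Z)
      (h : S ∩ Subtype.val '' R = T ∩ Subtype.val '' R) : S ⊆ T := by
    intro v hv
    obtain ⟨r, hr, hvr⟩ := hZR ⟨v, hS.1 hv⟩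
    have hrT : (r : V) ∈ T := (h ▸ ⟨mem_of_compl_reachable hS hv hvr, r, hr, rfl⟩ :
      (r : V) ∈ T ∩ Subtype.val '' R).1
    exact mem_of_compl_reachable hT hrT hvr.symm
  calc (completeSplits G Z).ncard ≤ (𝒫 (Subtype.val '' R)).ncard :=
        Set.ncard_le_ncard_of_injOn (· ∩ Subtype.val '' R) (fun _ _ => Set.inter_subset_right)
          (fun S hS T hT h =>
            (subset_of_inter_eq hS hT h).antisymm (subset_of_inter_eq hT hS h.symm))
    _ = 2 ^ (Subtype.val '' R).ncard := Set.ncard_powerset _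
    _ ≤ 2 ^ G.cliqueNum := Nat.pow_le_pow_right two_pos hle

theorem exists_range_eq [Finite V] (hne : R.Nonempty) (hk : R.ncard ≤ k) :
    ∃ p : Fin k → V, Set.range p = R := by
  have := hne.to_subtype
  have := Fintype.ofFinite R
  have e : Nonempty (R ↪ Fin k) := Function.Embedding.nonempty_of_card_le (by
    rwa [Fintype.card_fin, ← Nat.card_eq_fintype_card])
  obtain ⟨f, hf⟩ := Function.exists_surjective_iff.2 ⟨inferInstance, e⟩
  exact ⟨Subtype.val ∘ f, by rw [hf.range_comp, Subtype.range_coe]⟩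

end CliqueNumber

section Separators

variable {V : Type*} {G : SimpleGraph V} {P S T U W X : Set V} {a b u v x : V}

/-- The component of `a` in `G[W] - X` is a full component of `X`, with respect to `G[W]`. -/
def IsFullIn (G : SimpleGraph V) (W X : Set V) (a : V) : Prop :=
  a ∈ W \ X ∧ W ∩ G.openNbhd (compIn G (W \ X) a) = X

/-- `X` is a minimal separator of `G[W]`. Working with a set `W` of a fixed graph allows for
inductions on induced subgraphs. -/
def IsMinSepIn (G : SimpleGraph V) (W X : Set V) : Prop :=
  ∃ a b, IsFullIn G W X a ∧ IsFullIn G W X b ∧ b ∉ compIn G (W \ X) a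

/-- The vertices of `G[W]` that neither belong to `P` nor have a neighbour in `P`. -/
def undominated (G : SimpleGraph V) (W P : Set V) : Set V :=
  W \ (P ∪ G.openNbhd P)

theorem isMinSepIn_univ_of_isMinimalSeparator (h : G.IsMinimalSeparator X) :
    IsMinSepIn G Set.univ X := by
  obtain ⟨A, B, hAB, hA, hB⟩ := h
  obtain ⟨a, rfl⟩ := A.exists_rep
  obtain ⟨b, rfl⟩ := B.exists_rep
  have isFullIn (c : (Xᶜ : Set V))
      (hc : G.IsFullComponent X ((G.induce Xᶜ).connectedComponentMk c)) :
      IsFullIn G Set.univ X c := by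
    rw [IsFullIn, ← Set.compl_eq_univ_sdiff, Set.univ_inter, ← image_supp_connectedComponentMk]
    exact ⟨c.2, hc⟩
  refine ⟨a, b, isFullIn a hA, isFullIn b hB, fun hab => hAB ?_⟩
  rw [← Set.compl_eq_univ_sdiff, ← image_supp_connectedComponentMk] at hab
  obtain ⟨c, hc, hcb⟩ := hab
  exact (Subtype.val_injective hcb ▸ hc).symm

theorem IsFullIn.exists_adj (h : IsFullIn G W X a) (hx : x ∈ X) :
    ∃ y ∈ compIn G (W \ X) a, G.Adj x y :=
  have ⟨_, _, y, hy, hyx⟩ := h.2.ge hx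
  ⟨y, hy, hyx.symm⟩

theorem IsFullIn.mono (h : IsFullIn G W X a) (hS : S ⊆ X) : IsFullIn G W S a := by
  have ha : a ∈ W \ S := ⟨h.1.1, fun haS => h.1.2 (hS haS)⟩
  refine ⟨ha, (inter_openNbhd_compIn_subset ha).antisymm fun s hs => ?_⟩
  obtain ⟨hsW, hsC⟩ := h.2.ge (hS hs)
  exact ⟨hsW, openNbhd_mono (compIn_mono (Set.sdiff_subset_sdiff_right hS)) hsC
    fun hsC' => (compIn_subset ha hsC').2 hs⟩

theorem compIn_sdiff_inter_openNbhd (hUW : U ⊆ W) (hx : x ∈ U) :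
    compIn G (W \ (W ∩ G.openNbhd (compIn G U x))) x = compIn G U x := by
  rw [Set.sdiff_self_inter, compIn_sdiff_openNbhd hUW hx]

theorem isFullIn_inter_openNbhd (hUW : U ⊆ W) (hx : x ∈ U) :
    IsFullIn G W (W ∩ G.openNbhd (compIn G U x)) x :=
  ⟨⟨hUW hx, fun h => h.2.1 self_mem_compIn⟩, by rw [compIn_sdiff_inter_openNbhd hUW hx]⟩

theorem IsMinSepIn.subset (h : IsMinSepIn G W X) : X ⊆ W :=
  have ⟨_, _, ha, _⟩ := h
  fun _ hx => (ha.2.ge hx).1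

theorem exists_isMinSepIn_separating (hUW : U ⊆ W) (hu : u ∈ U) (hv : v ∈ U)
    (huv : v ∉ compIn G U u) :
    ∃ S, IsMinSepIn G W S ∧ U ⊆ W \ S ∧ v ∉ compIn G (W \ S) u := by
  set S₁ := W ∩ G.openNbhd (compIn G U u)
  have hUS₁ : U ⊆ W \ S₁ := fun y hy => ⟨hUW hy, fun h => notMem_openNbhd_compIn hu hy h.2⟩
  set S := W ∩ G.openNbhd (compIn G (W \ S₁) v)
  have hS : S ⊆ S₁ := inter_openNbhd_compIn_subset (hUS₁ hv)
  have hsep : v ∉ compIn G (W \ S) u := by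
    intro h
    have h' : u ∈ compIn G (W \ S₁) v := by
      rw [← compIn_sdiff_inter_openNbhd Set.sdiff_subset (hUS₁ hv)]
      exact mem_compIn_symm h
    exact huv (compIn_sdiff_inter_openNbhd hUW hu ▸ mem_compIn_symm h')
  exact ⟨S, ⟨u, v, (isFullIn_inter_openNbhd hUW hu).mono hS,
    isFullIn_inter_openNbhd Set.sdiff_subset (hUS₁ hv), hsep⟩,
    hUS₁.trans (Set.sdiff_subset_sdiff_right hS), hsep⟩

/-- With `A` and `B` full components of `X`, `P` dominates all vertices of `X` except those that
are complete to `B`; the latter form the set `T`. -/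
theorem IsMinSepIn.exists_eq_openNbhd [Finite V] (hP6 : ¬ (pathGraph 6).IsIndContained G)
    (h : IsMinSepIn G W X) :
    ∃ P b T, P.Nonempty ∧ P.ncard ≤ G.cliqueNum ∧
      T ∈ completeSplits G (G.neighborSet b ∩ undominated G W P) ∧
      W ∩ G.openNbhd (compIn G (undominated G W P \ T) b) = X := by
  obtain ⟨a, b, ha, hb, hab⟩ := h
  set A := compIn G (W \ X) a
  set B := compIn G (W \ X) b
  have hAU : A ⊆ W \ X := compIn_subset ha.1
  have hBU : B ⊆ W \ X := compIn_subset hb.1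
  have hdisj : ∀ v ∈ A, v ∉ B := fun v hvA hvB =>
    hab (mem_compIn_trans hvA (mem_compIn_symm hvB))
  have hanti : ∀ v ∈ A, ∀ w ∈ B, ¬ G.Adj v w := fun v hv w hw hvw =>
    hdisj w (mem_compIn_of_adj hv (hAU hv) (hBU hw) hvw) hw
  obtain ⟨P, hPA, hP, hPc, hdom⟩ := exists_isClique_dominating hP6
    connected_induce_compIn connected_induce_compIn.preconnected hanti
  set U := undominated G W P
  have complete : ∀ x ∈ X, x ∈ U → ∀ y ∈ B, G.Adj x y := fun x hx hxU =>
    (hdom x (ha.exists_adj hx) (hb.exists_adj hx)).resolve_left fun ⟨p, hp, hxp⟩ =>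
      hxU.2 (.inr ⟨fun hxP => hxU.2 (.inl hxP), p, hp, hxp.symm⟩)
  have hUX : U \ (G.neighborSet b ∩ U ∩ X) ⊆ W \ X := fun y hy =>
    ⟨hy.1.1, fun hyX => hy.2 ⟨⟨(complete y hyX hy.1 b self_mem_compIn).symm, hy.1⟩, hyX⟩⟩
  have hBU' : B ⊆ U \ (G.neighborSet b ∩ U ∩ X) := fun y hy =>
    ⟨⟨(hBU hy).1, fun h => h.elim (fun hyP => hdisj y (hPA hyP) hy)
      fun ⟨_, p, hp, hpy⟩ => hanti p (hPA hp) y hy hpy⟩, fun h => (hBU hy).2 h.2⟩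
  refine ⟨P, b, G.neighborSet b ∩ U ∩ X, hP, ncard_le_cliqueNum hPc,
    ⟨Set.inter_subset_left, ?_⟩, ?_⟩
  · rintro t ⟨⟨-, htU⟩, htX⟩ z ⟨hz, hzT⟩
    have hzX : z ∉ X := fun hzX => hzT ⟨hz, hzX⟩
    exact complete t htX htU z (mem_compIn_of_adj self_mem_compIn hb.1 ⟨hz.2.1, hzX⟩ hz.1)
  · rw [(compIn_mono hUX).antisymm (compIn_subset_compIn hBU')]
    exact hb.2

theorem ncard_isMinSepIn_le [Fintype V] (hP6 : ¬ (pathGraph 6).IsIndContained G) (W : Set V) :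
    {X | IsMinSepIn G W X}.ncard ≤ 2 ^ G.cliqueNum * Fintype.card V ^ (G.cliqueNum + 1) := by
  classical
  let F (q : (Fin G.cliqueNum → V) × V) : Set (Set V) :=
    (fun T => W ∩ G.openNbhd (compIn G (undominated G W (Set.range q.1) \ T) q.2)) ''
      completeSplits G (G.neighborSet q.2 ∩ undominated G W (Set.range q.1))
  have hsub : {X | IsMinSepIn G W X} ⊆ ⋃ q ∈ Finset.univ, F q := by
    intro X hX
    obtain ⟨P, b, T, hP, hPk, hT, hTX⟩ := IsMinSepIn.exists_eq_openNbhd hP6 hX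
    obtain ⟨p, rfl⟩ := exists_range_eq hP hPk
    exact Set.mem_biUnion (Finset.mem_univ (p, b)) ⟨T, hT, hTX⟩
  have hF (q) : (F q).ncard ≤ 2 ^ G.cliqueNum :=
    (Set.ncard_image_le (Set.toFinite _)).trans ncard_completeSplits_le
  calc _ ≤ (⋃ q ∈ Finset.univ, F q).ncard := Set.ncard_le_ncard hsub (Set.toFinite _)
    _ ≤ ∑ q, (F q).ncard := Finset.set_ncard_biUnion_le _ _
    _ ≤ ∑ _q : (Fin G.cliqueNum → V) × V, 2 ^ G.cliqueNum := Finset.sum_le_sum fun q _ => hF q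
    _ = 2 ^ G.cliqueNum * Fintype.card V ^ (G.cliqueNum + 1) := by
      simp [Fintype.card_prod, pow_succ, mul_comm]

end Separators

section PotentialMaximalCliques

variable {V : Type*} {G : SimpleGraph V} {S T U W Y Ω Ω' : Set V} {a u v x : V}

/-- The characterisation of Bouchitté and Todinca of the potential maximal cliques `Ω` of `G[W]`:
`Ω` has no full component, and every two nonadjacent vertices of `Ω` see a common component of
`G[W] - Ω`. -/
structure IsPotentialMaximalCliqueIn (G : SimpleGraph V) (W Ω : Set V) : Prop where
  subset : Ω ⊆ W
  not_subset_openNbhd : ∀ x ∈ W \ Ω, ¬ Ω ⊆ G.openNbhd (compIn G (W \ Ω) x)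
  exists_mem_openNbhd : ∀ u ∈ Ω, ∀ v ∈ Ω, u ≠ v → ¬ G.Adj u v → ∃ x ∈ W \ Ω,
    u ∈ G.openNbhd (compIn G (W \ Ω) x) ∧ v ∈ G.openNbhd (compIn G (W \ Ω) x)

namespace IsPotentialMaximalCliqueIn

theorem mem_openNbhd_compIn (h : IsPotentialMaximalCliqueIn G W Ω) (hu : u ∈ Ω) (hv : v ∈ Ω)
    (huY : u ∈ Y) (hvu : v ∉ compIn G Y u)
    (hY : ∀ x ∈ W \ Ω, u ∈ G.openNbhd (compIn G (W \ Ω) x) →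
      v ∈ G.openNbhd (compIn G (W \ Ω) x) → compIn G (W \ Ω) x ⊆ Y) :
    v ∈ G.openNbhd (compIn G Y u) := by
  by_cases huv : G.Adj u v
  · exact ⟨hvu, u, self_mem_compIn, huv⟩
  obtain ⟨x, hx, hux, hvx⟩ :=
    h.exists_mem_openNbhd u hu v hv (fun e => hvu (e ▸ self_mem_compIn)) huv
  exact openNbhd_mono (compIn_subset_compIn_of_mem_openNbhd (hY x hx hux hvx) huY hux) hvx hvu

theorem eq_of_subset (h : IsPotentialMaximalCliqueIn G W Ω)
    (h' : IsPotentialMaximalCliqueIn G W Ω') (hsub : Ω ⊆ Ω') : Ω = Ω' := by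
  refine hsub.antisymm fun a ha => by_contra fun haΩ => ?_
  have haU : a ∈ W \ Ω := ⟨h'.subset ha, haΩ⟩
  refine h.not_subset_openNbhd a haU fun w hw => ?_
  exact h'.mem_openNbhd_compIn ha (hsub hw) haU (fun hwa => (compIn_subset haU hwa).2 hw)
    fun x hx _ _ => (compIn_subset hx).trans (Set.sdiff_subset_sdiff_right hsub)

theorem isMinSepIn (h : IsPotentialMaximalCliqueIn G W Ω) (hx : x ∈ W \ Ω) :
    IsMinSepIn G W (W ∩ G.openNbhd (compIn G (W \ Ω) x)) := by
  set S := W ∩ G.openNbhd (compIn G (W \ Ω) x)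
  have hSΩ : S ⊆ Ω := inter_openNbhd_compIn_subset hx
  obtain ⟨w, hw, hwx⟩ := Set.not_subset.1 (h.not_subset_openNbhd x hx)
  have hwS : w ∈ W \ S := ⟨h.subset hw, fun h => hwx h.2⟩
  refine ⟨x, w, isFullIn_inter_openNbhd Set.sdiff_subset hx,
    ⟨hwS, (inter_openNbhd_compIn_subset hwS).antisymm fun s hs => ⟨hs.1, ?_⟩⟩, ?_⟩
  · exact h.mem_openNbhd_compIn hw (hSΩ hs) hwS (fun hsw => (compIn_subset hwS hsw).2 hs)
      fun y hy _ _ => (compIn_subset hy).trans (Set.sdiff_subset_sdiff_right hSΩ)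
  · rw [compIn_sdiff_inter_openNbhd Set.sdiff_subset hx]
    exact fun hwx => (compIn_subset hx hwx).2 hw

theorem sdiff_singleton_of_mem (h : IsPotentialMaximalCliqueIn G W Ω) (ha : a ∈ Ω) :
    IsPotentialMaximalCliqueIn G (W \ {a}) (Ω \ {a}) ∨ ∃ S, IsMinSepIn G W S ∧ Ω = insert a S := by
  have hU : (W \ {a}) \ (Ω \ {a}) = W \ Ω := by
    rw [Set.sdiff_sdiff, Set.union_sdiff_cancel (Set.singleton_subset_iff.2 ha)]
  by_cases hfull : ∃ x ∈ W \ Ω, Ω \ {a} ⊆ G.openNbhd (compIn G (W \ Ω) x)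
  · obtain ⟨x, hx, hxΩ⟩ := hfull
    refine .inr ⟨_, h.isMinSepIn hx, Set.Subset.antisymm (fun w hw => ?_)
      (Set.insert_subset ha (inter_openNbhd_compIn_subset hx))⟩
    exact or_iff_not_imp_left.2 fun hwa => ⟨h.subset hw, hxΩ ⟨hw, hwa⟩⟩
  · push Not at hfull
    refine .inl ⟨Set.sdiff_subset_sdiff_left h.subset, by rwa [hU], ?_⟩
    rw [hU]
    exact fun u hu v hv => h.exists_mem_openNbhd u hu.1 v hv.1

end IsPotentialMaximalCliqueIn

theorem exists_mem_openNbhd_of_mem_compIn (huU : u ∉ U) (hvU : v ∉ U) (hne : u ≠ v)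
    (huv : ¬ G.Adj u v) (h : v ∈ compIn G (U ∪ {u, v}) u) :
    ∃ x ∈ U, u ∈ G.openNbhd (compIn G U x) ∧ v ∈ G.openNbhd (compIn G U x) := by
  have notMem_comp {x y} (hx : x ∈ U) (hy : y ∉ U) : y ∉ compIn G U x :=
    fun hyx => hy (compIn_subset hx hyx)
  obtain ⟨p, q, -, hpq, -, hq, hp, hqS⟩ := exists_adj_of_mem_compIn
    (S := {u} ∪ {z | z ∈ U ∧ u ∈ G.openNbhd (compIn G U z)}) h (.inl rfl)
    (by rintro (e | e); exacts [hne e.symm, hvU e.1])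
  rcases hq with hqU | rfl | rfl
  · refine (hqS (.inr ⟨hqU, ?_⟩)).elim
    rcases hp with rfl | ⟨hpU, hup⟩
    · exact ⟨notMem_comp hqU huU, q, self_mem_compIn, hpq.symm⟩
    · rwa [compIn_eq (mem_compIn_of_adj self_mem_compIn hpU hqU hpq)]
  · exact (hqS (.inl rfl)).elim
  · rcases hp with rfl | ⟨hpU, hup⟩
    · exact (huv hpq).elim
    · exact ⟨p, hpU, hup, notMem_comp hpU hvU, p, self_mem_compIn, hpq⟩

namespace IsPotentialMaximalCliqueIn

/-- A vertex of `Ω` outside `T` that the component of `a` does not see would be connected to both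
`u` and `v` in `G[W] - T`. -/
theorem eq_union_of_separating (h : IsPotentialMaximalCliqueIn G W Ω) (haU : a ∈ W \ Ω)
    (hu : u ∈ Ω) (hv : v ∈ Ω) (hua : u ∈ G.openNbhd (compIn G (W \ Ω) a))
    (hva : v ∈ G.openNbhd (compIn G (W \ Ω) a)) (hTW : T ⊆ W)
    (hT : ((W \ Ω) \ {a}) ∪ {u, v} ⊆ W \ T) (hsep : v ∉ compIn G (W \ T) u) :
    Ω = W ∩ G.openNbhd (compIn G (W \ Ω) a) ∪ T \ {a} := by
  have connected {w x} (hw : w ∈ Ω) (hwT : w ∈ W \ T) (hx : x ∈ Ω) (hxT : x ∈ W \ T)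
      (hxa : x ∉ G.openNbhd (compIn G (W \ Ω) a)) : x ∈ compIn G (W \ T) w := by
    by_contra hxw
    refine notMem_openNbhd_compIn hwT hxT
      (h.mem_openNbhd_compIn hw hx hwT hxw fun t ht _ hxt s hs => hT (.inl ?_))
    refine ⟨compIn_subset ht hs, ?_⟩
    rintro rfl
    exact hxa (compIn_eq hs ▸ hxt)
  refine Set.Subset.antisymm (fun x hx => ?_) (Set.union_subset
    (inter_openNbhd_compIn_subset haU) fun t ht => ?_)
  · by_contra hxST
    have hxa : x ∉ G.openNbhd (compIn G (W \ Ω) a) := fun e => hxST (.inl ⟨h.subset hx, e⟩)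
    have hxT : x ∈ W \ T :=
      ⟨h.subset hx, fun e => hxST (.inr ⟨e, fun hxa => haU.2 (hxa ▸ hx)⟩)⟩
    exact hsep (mem_compIn_trans (connected hu (hT (.inr (.inl rfl))) hx hxT hxa)
      (mem_compIn_symm (connected hv (hT (.inr (.inr rfl))) hx hxT hxa)))
  · by_contra htΩ
    exact (hT (.inl ⟨⟨hTW ht.1, htΩ⟩, ht.2⟩)).2 ht.1

theorem sdiff_singleton_of_notMem (h : IsPotentialMaximalCliqueIn G W Ω) (haU : a ∈ W \ Ω) :
    IsPotentialMaximalCliqueIn G (W \ {a}) Ω ∨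
      ∃ S T, IsMinSepIn G W S ∧ IsMinSepIn G W T ∧ Ω = S ∪ T \ {a} := by
  have hU : (W \ {a}) \ Ω = (W \ Ω) \ {a} := Set.sdiff_sdiff_comm
  by_cases hcov : ∀ u ∈ Ω, ∀ v ∈ Ω, u ≠ v → ¬ G.Adj u v → ∃ x ∈ (W \ Ω) \ {a},
      u ∈ G.openNbhd (compIn G ((W \ Ω) \ {a}) x) ∧ v ∈ G.openNbhd (compIn G ((W \ Ω) \ {a}) x)
  · refine .inl ⟨Set.subset_sdiff_singleton h.subset haU.2, ?_, by rwa [hU]⟩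
    rw [hU]
    exact fun x hx hxΩ => h.not_subset_openNbhd x hx.1 fun w hw =>
      openNbhd_mono (compIn_mono Set.sdiff_subset) (hxΩ hw) fun hwx => (compIn_subset hx.1 hwx).2 hw
  push Not at hcov
  obtain ⟨u, hu, v, hv, hne, huv, hno⟩ := hcov
  have hsee : u ∈ G.openNbhd (compIn G (W \ Ω) a) ∧ v ∈ G.openNbhd (compIn G (W \ Ω) a) := by
    obtain ⟨x, hx, hux, hvx⟩ := h.exists_mem_openNbhd u hu v hv hne huv
    have hax : a ∈ compIn G (W \ Ω) x := by
      by_contra hax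
      have hxU : compIn G (W \ Ω) x ⊆ (W \ Ω) \ {a} :=
        Set.subset_sdiff_singleton (compIn_subset hx) hax
      rw [(compIn_subset_compIn hxU).antisymm (compIn_mono Set.sdiff_subset)] at hux hvx
      exact hno x (hxU self_mem_compIn) hux hvx
    rw [compIn_eq hax]
    exact ⟨hux, hvx⟩
  have hsep : v ∉ compIn G ((W \ Ω) \ {a} ∪ {u, v}) u := fun hvu =>
    have ⟨x, hx, hux, hvx⟩ :=
      exists_mem_openNbhd_of_mem_compIn (fun e => e.1.2 hu) (fun e => e.1.2 hv) hne huv hvu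
    hno x hx hux hvx
  obtain ⟨T, hT, hTU, hTsep⟩ := exists_isMinSepIn_separating
    (Set.union_subset (Set.sdiff_subset.trans Set.sdiff_subset)
      (Set.pair_subset (h.subset hu) (h.subset hv))) (.inr (.inl rfl)) (.inr (.inr rfl)) hsep
  exact .inr ⟨_, T, h.isMinSepIn haU, hT,
    h.eq_union_of_separating haU hu hv hsee.1 hsee.2 hT.subset hTU hTsep⟩

end IsPotentialMaximalCliqueIn

theorem injOn_sdiff_singleton :
    Set.InjOn (· \ {a}) {Ω | IsPotentialMaximalCliqueIn G W Ω} := by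
  intro Ω hΩ Ω' hΩ' (h : Ω \ {a} = Ω' \ {a})
  by_cases ha : a ∈ Ω
  · refine (hΩ'.eq_of_subset hΩ ?_).symm
    exact (Set.subset_insert_sdiff_singleton a Ω').trans (h ▸ Set.insert_subset ha Set.sdiff_subset)
  · refine hΩ.eq_of_subset hΩ' ?_
    rw [← Set.sdiff_singleton_eq_self ha, h]
    exact Set.sdiff_subset

theorem ncard_isPotentialMaximalCliqueIn_le_add [Finite V] {s : ℕ} (ha : a ∈ W)
    (hs : {X | IsMinSepIn G W X}.ncard ≤ s) :
    {Ω | IsPotentialMaximalCliqueIn G W Ω}.ncard ≤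
      {Ω | IsPotentialMaximalCliqueIn G (W \ {a}) Ω}.ncard + (s + s * s) := by
  set M := {X | IsMinSepIn G W X}
  let P : Set (Set V) :=
    {Ω | IsPotentialMaximalCliqueIn G W Ω ∧ IsPotentialMaximalCliqueIn G (W \ {a}) (Ω \ {a})}
  let Q : Set (Set V) := insert a '' M
  let R : Set (Set V) := (fun q : Set V × Set V => q.1 ∪ q.2 \ {a}) '' (M ×ˢ M)
  have hsub : {Ω | IsPotentialMaximalCliqueIn G W Ω} ⊆ P ∪ (Q ∪ R) := by
    intro Ω hΩ
    by_cases haΩ : a ∈ Ω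
    · rcases hΩ.sdiff_singleton_of_mem haΩ with h | ⟨S, hS, rfl⟩
      · exact .inl ⟨hΩ, h⟩
      · exact .inr (.inl ⟨S, hS, rfl⟩)
    · rcases hΩ.sdiff_singleton_of_notMem ⟨ha, haΩ⟩ with h | ⟨S, T, hS, hT, rfl⟩
      · exact .inl ⟨hΩ, by rwa [Set.sdiff_singleton_eq_self haΩ]⟩
      · exact .inr (.inr ⟨(S, T), ⟨hS, hT⟩, rfl⟩)
  have hP : P.ncard ≤ {Ω | IsPotentialMaximalCliqueIn G (W \ {a}) Ω}.ncard :=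
    Set.ncard_le_ncard_of_injOn (· \ {a}) (fun _ hΩ => hΩ.2)
      (injOn_sdiff_singleton.mono fun _ hΩ => hΩ.1)
  have hQ : Q.ncard ≤ s := (Set.ncard_image_le (Set.toFinite _)).trans hs
  have hR : R.ncard ≤ s * s :=
    (Set.ncard_image_le (Set.toFinite _)).trans (Set.ncard_prod.trans_le (Nat.mul_le_mul hs hs))
  calc _ ≤ (P ∪ (Q ∪ R)).ncard := Set.ncard_le_ncard hsub
    _ ≤ P.ncard + (Q.ncard + R.ncard) :=
      (Set.ncard_union_le _ _).trans (Nat.add_le_add_left (Set.ncard_union_le _ _) _)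
    _ ≤ _ := by gcongr

theorem ncard_isPotentialMaximalCliqueIn_le [Finite V] {s : ℕ}
    (hs : ∀ W : Set V, {X | IsMinSepIn G W X}.ncard ≤ s) (W : Set V) :
    {Ω | IsPotentialMaximalCliqueIn G W Ω}.ncard ≤ 1 + W.ncard * (s + s * s) := by
  induction W, W.toFinite using Set.Finite.induction_on with
  | empty =>
    have : {Ω | IsPotentialMaximalCliqueIn G ∅ Ω} ⊆ {∅} :=
      fun Ω hΩ => Set.subset_empty_iff.1 hΩ.subset
    simpa using Set.ncard_le_ncard this
  | @insert a W ha _ ih =>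
    have h := ncard_isPotentialMaximalCliqueIn_le_add (Set.mem_insert a W) (hs (insert a W))
    rw [Set.insert_sdiff_self_of_notMem ha] at h
    rw [Set.ncard_insert_of_notMem ha]
    linarith

end PotentialMaximalCliques

section Chordal

variable {V : Type*} {G H Γ : SimpleGraph V} {D K S U Ω : Set V} {m n : ℕ} {u v w x z : V}

theorem exists_mem_add_one_notMem {S : Set (Fin (n + 1))} {x y : Fin (n + 1)} (hx : x ∈ S)
    (hy : y ∉ S) : ∃ a ∈ S, a + 1 ∉ S := by
  by_contra! h
  have hadd (i : Fin (n + 1)) : x + i ∈ S := by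
    induction i using Fin.induction with
    | zero => simpa only [add_zero] using hx
    | succ i ih => simpa only [add_assoc, Fin.coeSucc_eq_succ] using h _ ih
  exact hy (by simpa only [add_sub_cancel] using hadd (y - x))

theorem cycleGraph_union_openNbhd_eq_univ {E : Set (Fin (n + 2))} (hE : E.Nonempty)
    (hN : (cycleGraph (n + 2)).IsClique ((cycleGraph (n + 2)).openNbhd E)) :
    E ∪ (cycleGraph (n + 2)).openNbhd E = Set.univ := by
  set N := (cycleGraph (n + 2)).openNbhd E
  by_contra hF
  obtain ⟨e, he⟩ := hE
  obtain ⟨f, hf⟩ := (Set.ne_univ_iff_exists_notMem _).1 hF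
  have adj_succ (i : Fin (n + 2)) : (cycleGraph (n + 2)).Adj i (i + 1) := by simp [cycleGraph_adj]
  obtain ⟨a, ha, haE⟩ := exists_mem_add_one_notMem he fun h => hf (.inl h)
  obtain ⟨b, hb, hbF⟩ := exists_mem_add_one_notMem (S := (E ∪ N)ᶜ) hf fun h => h (.inl he)
  have haN : a + 1 ∈ N := ⟨haE, a, ha, adj_succ a⟩
  have hbN : b + 1 ∈ N := (not_not.1 hbF).resolve_left fun hbE =>
    hb (.inr ⟨fun h => hb (.inl h), b + 1, hbE, (adj_succ b).symm⟩)
  have hab : a + 1 ≠ b + 1 := fun h => hb (.inl (add_right_cancel h ▸ ha))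
  have h := hN haN hbN hab
  rw [cycleGraph_adj, sub_eq_iff_eq_add', sub_eq_iff_eq_add', add_left_inj, add_left_inj] at h
  rcases h with rfl | rfl
  · exact hbN.1 ha
  · exact hb (.inr haN)

theorem mem_union_openNbhd_of_isClique (hN : H.IsClique (H.openNbhd D))
    (f : cycleGraph (n + 2) ↪g H) {i : Fin (n + 2)} (hi : f i ∈ D) (j : Fin (n + 2)) :
    f j ∈ D ∪ H.openNbhd D := by
  have hE : (cycleGraph (n + 2)).openNbhd (f ⁻¹' D) ⊆ f ⁻¹' H.openNbhd D :=
    fun l ⟨hl, k, hk, hkl⟩ => ⟨hl, f k, hk, f.map_adj_iff.2 hkl⟩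
  have huniv := cycleGraph_union_openNbhd_eq_univ ⟨i, hi⟩ fun k hk l hl hkl =>
    f.map_adj_iff.1 (hN (hE hk) (hE hl) (f.injective.ne hkl))
  exact (huniv.ge (Set.mem_univ j)).imp_right fun h => hE h

theorem cycleGraph_adj_of_lt {i j : Fin m} (h : i < j) :
    (cycleGraph m).Adj i j ↔ j.val = i.val + 1 ∨ (i.val = 0 ∧ j.val + 1 = m) := by
  have hij : (i - j).val = m + i - j := Fin.coe_sub_iff_lt.2 h
  have hji : (j - i).val = j - i := Fin.sub_val_of_le h.le
  rw [cycleGraph_adj', hij, hji]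
  rw [Fin.lt_def] at h
  omega

theorem dist_getVert {p : Γ.Walk z w} (hp : p.length = Γ.dist z w) {i : ℕ} (hi : i ≤ p.length) :
    Γ.dist z (p.getVert i) = i := by
  rw [← length_eq_dist_of_subwalk hp (p.isSubwalk_take i), Walk.take_length, min_eq_left hi]

theorem adj_getVert_iff {p : Γ.Walk z w} (hp : p.length = Γ.dist z w) {i j : ℕ} (hij : i < j)
    (hj : j ≤ p.length) : Γ.Adj (p.getVert i) (p.getVert j) ↔ j = i + 1 := by
  refine ⟨fun h => ?_, fun h => h ▸ p.adj_getVert_succ (by omega)⟩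
  have := h.diff_dist_adj (u := z)
  rw [dist_getVert hp hj, dist_getVert hp (hij.le.trans hj)] at this
  omega

/-- A shortest path from `z` to `w` in `H[S]` without the edge `zw` closes to an induced cycle. -/
theorem cycleGraph_isIndContained_of_reachable (hz : z ∈ S) (hzw : H.Adj z w)
    (hΓ : ∀ a b, Γ.Adj a b ↔ H.Adj a b ∧ a ∈ S ∧ b ∈ S ∧ s(a, b) ≠ s(z, w))
    (h : Γ.Reachable z w) : (cycleGraph (Γ.dist z w + 1)).IsIndContained H := by
  obtain ⟨p, hp⟩ := h.exists_walk_length_eq_dist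
  let f (i : Fin (Γ.dist z w + 1)) : V := p.getVert i
  have hdist (i) : Γ.dist z (f i) = i := dist_getVert hp (by omega)
  have hinj : Function.Injective f := fun i j hij => Fin.ext (by rw [← hdist i, hij, hdist])
  have hS (i) : f i ∈ S := by
    by_contra hi
    obtain ⟨a, b, -, hab, -, hb⟩ := exists_adj_of_reachable (p.take i).reachable hz hi
    exact hb ((hΓ a b).1 hab).2.2.1
  have hΓadj {i j} (hij : i < j) : Γ.Adj (f i) (f j) ↔ j.val = i.val + 1 :=
    adj_getVert_iff hp hij (by omega)
  have hend {i j} (hij : i < j) : s(f i, f j) = s(z, w) ↔ i = 0 ∧ j = Fin.last _ := by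
    have hzw : s(z, w) = s(f 0, f (Fin.last _)) := by simp [f, ← hp]
    rw [hzw, Sym2.eq_iff, hinj.eq_iff, hinj.eq_iff, hinj.eq_iff, hinj.eq_iff,
      or_iff_left fun h => (h.2 ▸ hij).not_ge (Fin.zero_le _)]
  have hadj {i j} (hij : i < j) : H.Adj (f i) (f j) ↔ (cycleGraph _).Adj i j := by
    have hsplit : H.Adj (f i) (f j) ↔ Γ.Adj (f i) (f j) ∨ s(f i, f j) = s(z, w) := by
      by_cases he : s(f i, f j) = s(z, w)
      · exact iff_of_true ((H.adj_congr_of_sym2 he).2 hzw) (.inr he)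
      · simp [hΓ, hS, he]
    rw [hsplit, hΓadj hij, hend hij, cycleGraph_adj_of_lt hij, add_left_inj, Fin.ext_iff,
      Fin.ext_iff, Fin.val_zero, Fin.val_last]
  refine ⟨⟨⟨f, hinj⟩, fun {i j} => ?_⟩⟩
  rcases lt_trichotomy i j with hij | rfl | hij
  · exact hadj hij
  · simp
  · exact (H.adj_comm _ _).trans ((hadj hij).trans (adj_comm _ _ _))

theorem commonNeighbors_nonempty_of_dist_le_two (h : Γ.Reachable z w) (hne : z ≠ w)
    (hadj : ¬ Γ.Adj z w) (hdist : Γ.dist z w ≤ 2) : (Γ.commonNeighbors z w).Nonempty := by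
  by_contra hempty
  rw [← not_lt, ← Nat.cast_lt (α := ℕ∞), h.coe_dist_eq_edist, Nat.cast_two, two_lt_edist_iff,
    ← Set.not_nonempty_iff_eq_empty] at hdist
  exact hdist ⟨hne, hadj, hempty⟩

theorem exists_adj_adj_of_mem_openNbhd (hH : H.IsChordal) (hzw : H.Adj z w)
    (hz : z ∈ H.openNbhd (compIn H U x)) (hw : w ∈ H.openNbhd (compIn H U x)) :
    ∃ y ∈ compIn H U x, H.Adj y z ∧ H.Adj y w := by
  let S := compIn H U x ∪ {z, w}
  let Γ : SimpleGraph V := (H.induce S).spanningCoe.deleteEdges {s(z, w)}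
  have hΓ (a b) : Γ.Adj a b ↔ H.Adj a b ∧ a ∈ S ∧ b ∈ S ∧ s(a, b) ≠ s(z, w) := by
    rw [deleteEdges_adj, spanningCoe_induce_adj, Set.mem_singleton_iff, and_assoc, and_assoc]
  have hedge {a} (ha : a ∈ compIn H U x) (b) : s(a, b) ≠ s(z, w) := by
    rw [Ne, Sym2.eq_iff]
    rintro (⟨rfl, -⟩ | ⟨rfl, -⟩)
    exacts [hz.1 ha, hw.1 ha]
  have hreach {y} (hy : y ∈ compIn H U x) : Γ.Reachable x y := by
    refine compIn_subset_of_closed (S := {y | Γ.Reachable x y}) .rfl ?_ hy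
    exact fun a ha b hab haU hb hxa => hxa.trans (Adj.reachable
      ((hΓ a b).2 ⟨hab, .inl ha, .inl (mem_compIn_of_adj ha haU hb hab), hedge ha b⟩))
  have hreach_of_mem {y} (hyS : y ∈ S) (hy : y ∈ H.openNbhd (compIn H U x)) : Γ.Reachable x y :=
    have ⟨_, a, ha, hay⟩ := hy
    (hreach ha).trans (Adj.reachable ((hΓ a y).2 ⟨hay, .inl ha, hyS, hedge ha y⟩))
  have hzS : z ∈ S := .inr (.inl rfl)
  have hzw' : Γ.Reachable z w :=
    (hreach_of_mem hzS hz).symm.trans (hreach_of_mem (.inr (.inr rfl)) hw)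
  have hdist : Γ.dist z w ≤ 2 := by
    by_contra hdist
    exact hH _ (by omega) (cycleGraph_isIndContained_of_reachable hzS hzw hΓ hzw')
  obtain ⟨y, hzy, hwy⟩ := commonNeighbors_nonempty_of_dist_le_two hzw' hzw.ne
    (fun h => ((hΓ z w).1 h).2.2.2 rfl) hdist
  obtain ⟨hzy, -, hyS, -⟩ := (hΓ z y).1 hzy
  obtain ⟨hwy, -⟩ := (hΓ w y).1 hwy
  have hy : y ∉ ({z, w} : Set V) := by
    rintro (rfl | rfl)
    exacts [hzy.ne rfl, hwy.ne rfl]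
  exact ⟨y, hyS.resolve_right hy, hzy.symm, hwy.symm⟩

theorem exists_forall_adj_of_subset_openNbhd [Finite V] (hH : H.IsChordal) (hK : H.IsClique K)
    (hKD : K ⊆ H.openNbhd (compIn H U x)) : ∃ d ∈ compIn H U x, ∀ w ∈ K, H.Adj d w := by
  set D := compIn H U x
  obtain ⟨d, hd, hmax⟩ :=
    D.toFinite.exists_maximalFor (fun y => {w ∈ K | H.Adj y w}) _ ⟨x, self_mem_compIn⟩
  refine ⟨d, hd, fun w hw => by_contra fun hdw => ?_⟩
  -- `e` is the second-to-last vertex of a path from `d` to `w` through `D`.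
  obtain ⟨c, e, hc, hce, he, hew⟩ : ∃ c e, c ∈ compIn H (D \ H.neighborSet w) d ∧ H.Adj c e ∧
      e ∈ D ∧ H.Adj w e := by
    obtain ⟨-, y, hyD, hyw⟩ := hKD hw
    have hdD : d ∈ D \ H.neighborSet w := ⟨hd, fun h => hdw (Adj.symm h)⟩
    have hdy : y ∈ compIn H D d := compIn_subset_compIn (compIn_eq hd).subset
      (mem_compIn_trans (mem_compIn_symm hd) hyD)
    obtain ⟨c, e, -, hce, -, heD, hc, he⟩ := exists_adj_of_mem_compIn hdy
      (S := compIn H (D \ H.neighborSet w) d) self_mem_compIn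
      fun hy => (compIn_subset hdD hy).2 hyw.symm
    exact ⟨c, e, hc, hce, heD, by_contra fun hew =>
      he (mem_compIn_of_adj hc (compIn_subset hdD hc) ⟨heD, hew⟩ hce)⟩
  set U' := insert e (D \ H.neighborSet w)
  have hU' : D \ H.neighborSet w ⊆ U' := Set.subset_insert _ _
  have hdU' : d ∈ U' := hU' ⟨hd, fun h => hdw (Adj.symm h)⟩
  have hcU' : c ∈ compIn H U' d := compIn_mono hU' hc
  have heU' : e ∈ compIn H U' d :=
    mem_compIn_of_adj hcU' (compIn_subset hdU' hcU') (.inl rfl) hce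
  have hU'D : compIn H U' d ⊆ D :=
    (compIn_subset hdU').trans (Set.insert_subset he Set.sdiff_subset)
  have he_adj : ∀ z ∈ K, H.Adj d z → H.Adj e z := by
    intro z hz hdz
    have hzw : H.Adj z w := hK hz hw (by rintro rfl; exact hdw hdz)
    obtain ⟨p, hp, hpz, hpw⟩ := exists_adj_adj_of_mem_openNbhd hH hzw
      ⟨fun h => (hKD hz).1 (hU'D h), d, self_mem_compIn, hdz⟩
      ⟨fun h => (hKD hw).1 (hU'D h), e, heU', hew.symm⟩
    rcases compIn_subset hdU' hp with rfl | hp'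
    · exact hpz
    · exact (hp'.2 hpw.symm).elim
  exact hdw (hmax he (fun z hz => ⟨hz.1, he_adj z hz.1 hz.2⟩) ⟨hw, hew.symm⟩).2

/-- The subgraph of `H` formed by its edges inside the sets `C ∪ N_G(C)`, for the components `C` of
`G - Ω`, and its edges inside `Ω` other than `uv`. For a maximal clique `Ω` of a minimal
triangulation `H` of `G`, it is a competitor of `H` in case no `C` sees both `u` and `v`. -/
def splitFill (G H : SimpleGraph V) (Ω : Set V) (u v : V) : SimpleGraph V where
  Adj a b := H.Adj a b ∧
    ((∃ x ∉ Ω, a ∈ compIn G Ωᶜ x ∪ G.openNbhd (compIn G Ωᶜ x) ∧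
        b ∈ compIn G Ωᶜ x ∪ G.openNbhd (compIn G Ωᶜ x)) ∨
      (a ∈ Ω ∧ b ∈ Ω ∧ s(a, b) ≠ s(u, v)))
  symm := ⟨fun _ _ h => ⟨h.1.symm, h.2.imp (fun ⟨x, hx, ha, hb⟩ => ⟨x, hx, hb, ha⟩)
    fun ⟨ha, hb, hab⟩ => ⟨hb, ha, Sym2.eq_swap.trans_ne hab⟩⟩⟩
  loopless := ⟨fun _ h => H.irrefl h.1⟩

theorem openNbhd_compIn_compl_subset (hx : x ∉ Ω) : G.openNbhd (compIn G Ωᶜ x) ⊆ Ω :=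
  fun _ hy => by_contra fun hyΩ => notMem_openNbhd_compIn (U := Ωᶜ) hx hyΩ hy

theorem le_splitFill (hGH : G ≤ H) (huv : ¬ G.Adj u v) : G ≤ splitFill G H Ω u v := by
  have of_notMem {a b} (ha : a ∉ Ω) (hab : G.Adj a b) : (splitFill G H Ω u v).Adj a b :=
    ⟨hGH hab, .inl ⟨a, ha, .inl self_mem_compIn,
      or_iff_not_imp_left.2 fun hb => ⟨hb, a, self_mem_compIn, hab⟩⟩⟩
  intro a b hab
  by_cases ha : a ∈ Ω
  · by_cases hb : b ∈ Ω
    · exact ⟨hGH hab, .inr ⟨ha, hb, fun h => huv ((G.adj_congr_of_sym2 h).1 hab)⟩⟩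
    · exact (of_notMem hb hab.symm).symm
  · exact of_notMem ha hab

theorem openNbhd_splitFill_subset (hx : x ∉ Ω) :
    (splitFill G H Ω u v).openNbhd (compIn G Ωᶜ x) ⊆ G.openNbhd (compIn G Ωᶜ x) := by
  rintro b ⟨hb, a, ha, -, ⟨y, hy, hay, hby⟩ | ⟨haΩ, -⟩⟩
  · have haΩ : a ∉ Ω := compIn_subset (U := Ωᶜ) hx ha
    have hay : a ∈ compIn G Ωᶜ y :=
      hay.resolve_right fun h => haΩ (openNbhd_compIn_compl_subset hy h)
    rw [← compIn_eq hay, compIn_eq ha] at hby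
    exact hby.resolve_left hb
  · exact (compIn_subset (U := Ωᶜ) hx ha haΩ).elim

theorem isChordal_splitFill (hH : H.IsChordal) (hΩ : H.IsClique Ω) :
    (splitFill G H Ω u v).IsChordal := by
  rintro m hm ⟨f⟩
  obtain ⟨n, rfl⟩ := Nat.exists_eq_add_of_le' hm
  by_cases hf : ∃ i, f i ∉ Ω
  · obtain ⟨i, hi⟩ := hf
    have hN : (splitFill G H Ω u v).IsClique
        ((splitFill G H Ω u v).openNbhd (compIn G Ωᶜ (f i))) := fun a ha b hb hab =>
      have ha := openNbhd_splitFill_subset hi ha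
      have hb := openNbhd_splitFill_subset hi hb
      ⟨hΩ (openNbhd_compIn_compl_subset hi ha) (openNbhd_compIn_compl_subset hi hb) hab,
        .inl ⟨f i, hi, .inr ha, .inr hb⟩⟩
    have hmem (j) := (mem_union_openNbhd_of_isClique hN f self_mem_compIn j).imp_right
      (openNbhd_splitFill_subset hi ·)
    have hadj (j k) : H.Adj (f j) (f k) ↔ (cycleGraph (n + 4)).Adj j k :=
      ⟨fun h => f.map_adj_iff.1 ⟨h, .inl ⟨f i, hi, hmem j, hmem k⟩⟩, fun h => (f.map_adj_iff.2 h).1⟩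
    exact hH _ hm ⟨⟨f.toEmbedding, hadj _ _⟩⟩
  · push Not at hf
    have hpair (i : ℕ) (hi : i < 2) : s(f ⟨i, by omega⟩, f ⟨i + 2, by omega⟩) = s(u, v) := by
      by_contra h
      have hlt : (⟨i, by omega⟩ : Fin (n + 4)) < ⟨i + 2, by omega⟩ := Fin.mk_lt_mk.2 (by omega)
      have hadj := f.map_adj_iff.1
        ⟨hΩ (hf _) (hf _) (f.injective.ne hlt.ne), .inr ⟨hf _, hf _, h⟩⟩
      rw [cycleGraph_adj_of_lt hlt] at hadj
      dsimp only at hadj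
      omega
    have h := (hpair 0 (by omega)).trans (hpair 1 (by omega)).symm
    simp only [Sym2.eq_iff, f.injective.eq_iff, Fin.mk.injEq] at h
    omega

theorem exists_mem_openNbhd_of_isMinimalTriangulation (hH : G.IsMinimalTriangulation H)
    (hΩ : H.IsClique Ω) (hu : u ∈ Ω) (hv : v ∈ Ω) (hne : u ≠ v) (huv : ¬ G.Adj u v) :
    ∃ x ∉ Ω, u ∈ G.openNbhd (compIn G Ωᶜ x) ∧ v ∈ G.openNbhd (compIn G Ωᶜ x) := by
  have hle : H ≤ splitFill G H Ω u v :=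
    hH.le_of_le ⟨le_splitFill hH.prop.1 huv, isChordal_splitFill hH.prop.2 hΩ⟩ fun _ _ h => h.1
  rcases (hle (hΩ hu hv hne)).2 with ⟨x, hx, hux, hvx⟩ | ⟨-, -, h⟩
  · exact ⟨x, hx, hux.resolve_left fun h => compIn_subset (U := Ωᶜ) hx h hu,
      hvx.resolve_left fun h => compIn_subset (U := Ωᶜ) hx h hv⟩
  · exact (h rfl).elim

theorem not_subset_openNbhd_of_maximal_isClique [Finite V] (hGH : G ≤ H) (hH : H.IsChordal)
    (hΩ : Maximal H.IsClique Ω) (hx : x ∉ Ω) : ¬ Ω ⊆ G.openNbhd (compIn G Ωᶜ x) := by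
  intro hsub
  have hH_sub : Ω ⊆ H.openNbhd (compIn H Ωᶜ x) := fun w hw =>
    have ⟨_, y, hy, hyw⟩ := hsub hw
    ⟨fun h => compIn_subset (U := Ωᶜ) hx h hw, y, compIn_mono_graph hGH hy, hGH hyw⟩
  obtain ⟨d, hd, hdΩ⟩ := exists_forall_adj_of_subset_openNbhd hH hΩ.prop hH_sub
  have hclique : H.IsClique (insert d Ω) := hΩ.prop.insert fun w hw _ => hdΩ w hw
  exact compIn_subset (U := Ωᶜ) hx hd
    (hΩ.le_of_ge hclique (Set.subset_insert _ _) (Set.mem_insert _ _))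

theorem isPotentialMaximalCliqueIn_univ [Finite V] (h : G.IsPotentialMaximalClique Ω) :
    IsPotentialMaximalCliqueIn G Set.univ Ω := by
  obtain ⟨H, hH, hΩ⟩ := h
  refine ⟨Set.subset_univ _, ?_, ?_⟩ <;> rw [← Set.compl_eq_univ_sdiff]
  · exact fun x hx => not_subset_openNbhd_of_maximal_isClique hH.prop.1 hH.prop.2 hΩ hx
  · exact fun u hu v hv => exists_mem_openNbhd_of_isMinimalTriangulation hH hΩ.prop hu hv

end Chordal

end SeparatorBounds

open SeparatorBounds

theorem theorem1p3 {V : Type*} [Fintype V] [Nonempty V] (G : SimpleGraph V) (n k : ℕ)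
    (hn : Fintype.card V = n) (hk : G.cliqueNum = k)
    (hP6 : ¬ (SimpleGraph.pathGraph 6).IsIndContained G) :
    {X : Set V | G.IsMinimalSeparator X}.ncard ≤ (2 * n) ^ (k + 1) ∧
    {Ω : Set V | G.IsPotentialMaximalClique Ω}.ncard ≤ 2 ^ (2 * k + 2) * n ^ (2 * k + 3) := by
  subst hn hk
  set n := Fintype.card V
  set s := 2 ^ G.cliqueNum * n ^ (G.cliqueNum + 1) with hs
  have hsep (W : Set V) : {X | IsMinSepIn G W X}.ncard ≤ s := ncard_isMinSepIn_le hP6 W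
  constructor
  · calc _ ≤ {X | IsMinSepIn G Set.univ X}.ncard :=
          Set.ncard_le_ncard fun _ => isMinSepIn_univ_of_isMinimalSeparator
      _ ≤ s := hsep _
      _ ≤ 2 ^ (G.cliqueNum + 1) * n ^ (G.cliqueNum + 1) := by rw [hs]; gcongr <;> omega
      _ = _ := (mul_pow _ _ _).symm
  · have hn : 0 < n := Fintype.card_pos
    calc _ ≤ {Ω | IsPotentialMaximalCliqueIn G Set.univ Ω}.ncard :=
          Set.ncard_le_ncard fun _ => isPotentialMaximalCliqueIn_univ
      _ ≤ 1 + n * (s + s * s) := by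
          simpa [n] using ncard_isPotentialMaximalCliqueIn_le hsep Set.univ
      _ ≤ 4 * n * (s * s) := by
          have hs' : 1 ≤ s := Nat.mul_pos (by positivity) (by positivity)
          nlinarith [Nat.mul_le_mul hs' hs', Nat.mul_le_mul hn (Nat.mul_le_mul hs' hs'),
            Nat.mul_le_mul_left n (Nat.mul_le_mul_left s hs')]
      _ = _ := by rw [hs]; ring
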